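/- Energy harvesting channel with causal energy information. Let $\mathcal X\ni 0$ and $\mathcal Y$ be finite alphabets, $p(y\mid x)$ a discrete memoryless channel from $\mathcal X$ to $\mathcal Y$, $\overline B\ge 0$ an integer (battery capacity), $\mathcal E_B=\{0,1,\dots,\overline B\}$, $\mathcal E_H$ a finite set of non-negative integers, $\gamma:\mathcal X\to\mathbb Z_{\ge 0}$ a cost function with $\gamma(0)=0$, and $S:\mathcal E_B\times\mathcal E_H\to\mathbb Z_{\ge 0}$ a function (available energy) such that $S(b,e)$ is nondecreasing in $b$ for every $e$. The initial battery level $B_1$ is an $\mathcal E_B$-valued random variable with an arbitrary law, and the harvested energies $E_1,E_2,\dots$ are i.i.d. $\mathcal E_H$-valued random variables, independent of $B_1$. If $x_n$ is transmitted at time $n$, the battery evolves by $$ s_n=S(b_n,e_n),\qquad b_{n+1}=\min\{s_n-\gamma(x_n),\overline B\},\qquad\text{subject to } \gamma(x_n)\le s_n. \tag{1}$$ Let $\mathcal U^{(N)}$ be the set of all maps $u^N:\mathcal E_B\times\mathcal E_H^N\to\mathcal X^N$, $u^N=(u_1,\dots,u_N)$, where $x_n=u_n(b_1,e^n)$ depends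 only on $b_1$ and $e^n=(e_1,\dots,e_n)$, such that (1) holds for all $b_1\in\mathcal E_B$ and $e^N\in\mathcal E_H^N$. A block code of length $N$ with $M\ge 1$ messages consists of an encoder $\{1,\dots,M\}\to\mathcal U^{(N)}$ and a decoder $\mathcal Y^N\to\{1,\dots,M\}$; the output has the transition probabilities $$p(y^N\mid u^N)=\sum_{b_1,e^N}p(b_1)\,p(e^N)\prod_{n=1}^N p\bigl(y_n\mid x_n=u_n(b_1,e^n)\bigr).$$ A rate $R$ is achievable if for every $\varepsilon>0$ and all sufficiently large $n$ there is a block code of length $n$ with $M$ messages, $\frac1n\log_2 M\ge R-\varepsilon$, and maximal error probability at most $\varepsilon$. The capacity is the supremum of the achievable rates. Then for each $N\ge1$ the maximum $$\underline C_N=\max_{P_{U^N}}\frac1N I(U^N;Y^N\mid B_1=0)$$ over all probability distributions on $\mathcal U^{(N)}$ exists, where the mutual information (in bits) is that of the channel $p(y^N\mid u^N,b_1=0)=\sum_{e^N}p(e^N)\prod_{n=1}^N p(y_n\mid x_n=u_n(0,e^n))$; $\underline C_N$ is an achievable rate, and hence a lower bound for the capacity. Moreover $\lim_{N\to\infty}\underline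 C_N$ exists, is finite, and equals $\sup_{N\ge1}\underline C_N$. -/

import Mathlib

open MeasureTheory ProbabilityTheory Filter Topology
open scoped BigOperators

/-- A discrete energy harvesting system with a finite battery over a discrete memoryless channel.
`X` is the finite channel input alphabet (with a distinguished zero symbol), `Y` the finite output
alphabet. Energies are natural numbers: battery levels lie in `{0, …, cap}`, harvested energies in
the finite set `harvest`. -/
structure EHChannel (X Y : Type*) [Zero X] [Fintype Y] where
  /-- battery capacity -/
  cap : ℕ
  /-- alphabet of the harvested energies -/
  harvest : Finset ℕ
  /-- available energy as a function of the battery level and the harvested energy -/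
  avail : Fin (cap + 1) → harvest → ℕ
  /-- energy cost of a channel input symbol -/
  cost : X → ℕ
  cost_zero : cost 0 = 0
  /-- transition probabilities `p(y | x)` of the memoryless channel -/
  W : X → Y → ℝ
  W_nonneg : ∀ x y, 0 ≤ W x y
  W_sum : ∀ x, ∑ y, W x y = 1

namespace EHChannel

section

variable {X Y : Type*} [Zero X] [Fintype Y] (C : EHChannel X Y)

/-- Battery level after `n` transmissions, from the initial level `b₁`, the harvested energies `e`
and the transmitted symbols `x`:
`b ↦ min (S(b, e) - γ(x), cap)` at each step (times are counted from `0`). -/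
def battery {N : ℕ} (b₁ : Fin (C.cap + 1)) (e : Fin N → C.harvest) (x : Fin N → X) :
    ℕ → Fin (C.cap + 1)
  | 0 => b₁
  | n + 1 =>
    if h : n < N then
      ⟨min (C.avail (battery b₁ e x n) (e ⟨n, h⟩) - C.cost (x ⟨n, h⟩)) C.cap,
        Nat.lt_succ_of_le (min_le_right _ _)⟩
    else battery b₁ e x n

/-- The energy constraint: no symbol costs more than the energy available at its transmission. -/
def EnergyOK {N : ℕ} (b₁ : Fin (C.cap + 1)) (e : Fin N → C.harvest) (x : Fin N → X) : Prop :=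
  ∀ n : Fin N, C.cost (x n) ≤ C.avail (C.battery b₁ e x n) (e n)

/-- The input alphabet of the equivalent channel for block length `N`, in the scenario where the
transmitter knows the initial battery level and causally observes the harvested energies: all maps
`(b₁, e₁, …, e_N) ↦ (x₁, …, x_N)` for which `x_n` depends on `b₁, e₁, …, e_n` only and which
satisfy the energy constraint for every `b₁` and every `e₁, …, e_N`. -/
def Input (N : ℕ) : Type _ :=
  {u : Fin (C.cap + 1) → (Fin N → C.harvest) → (Fin N → X) //
    (∀ b₁ e e' n, (∀ i ≤ n, e i = e' i) → u b₁ e n = u b₁ e' n) ∧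
    ∀ b₁ e, C.EnergyOK b₁ e (u b₁ e)}

instance [Finite X] (N : ℕ) : Finite (C.Input N) :=
  inferInstanceAs (Finite {u : Fin (C.cap + 1) → (Fin N → C.harvest) → (Fin N → X) //
    (∀ b₁ e e' n, (∀ i ≤ n, e i = e' i) → u b₁ e n = u b₁ e' n) ∧
    ∀ b₁ e, C.EnergyOK b₁ e (u b₁ e)})

noncomputable instance [Finite X] (N : ℕ) : Fintype (C.Input N) := Fintype.ofFinite _

variable {Ω : Type*} [MeasurableSpace Ω] (P : Measure Ω)
  (B₁ : Ω → Fin (C.cap + 1)) (E : ℕ → Ω → C.harvest)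

/-- `p(y^N | u^N)`: the output law of `N` channel uses for the input `u`, where `B₁` is the initial
battery level and `E 0, E 1, …` are the harvested energies (the first one has index `0`). -/
noncomputable def transition {N : ℕ} (u : C.Input N) (y : Fin N → Y) : ℝ :=
  ∑ b : Fin (C.cap + 1), ∑ e : Fin N → C.harvest,
    P.real {ω | B₁ ω = b ∧ ∀ i : Fin N, E i ω = e i} * ∏ i, C.W (u.1 b e i) (y i)

/-- `p(y^N | u^N, b₁)`: the output law when the initial battery level is `b`. The harvested
energies are independent of the initial level, so they keep their law. -/
noncomputable def transitionGiven (b : Fin (C.cap + 1)) {N : ℕ} (u : C.Input N)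
    (y : Fin N → Y) : ℝ :=
  ∑ e : Fin N → C.harvest,
    P.real {ω | ∀ i : Fin N, E i ω = e i} * ∏ i, C.W (u.1 b e i) (y i)

/-- A block code with `M` messages and block length `N`. -/
structure Code (M N : ℕ) where
  enc : Fin M → C.Input N
  dec : (Fin N → Y) → Fin M

variable {C} in
/-- Probability that message `m` is decoded incorrectly. -/
noncomputable def Code.errorProb {M N : ℕ} (c : C.Code M N) (m : Fin M) : ℝ :=
  ∑ y : Fin N → Y with c.dec y ≠ m, C.transition P B₁ E (c.enc m) y

/-- `R` (in bits per channel use) is achievable: for every `ε > 0` and all large `n` there is a code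
of block length `n`, of rate at least `R - ε` and with maximal error probability at most `ε`. -/
def Achievable (R : ℝ) : Prop :=
  ∀ ε > 0, ∀ᶠ n : ℕ in atTop, ∃ M : ℕ, 1 ≤ M ∧ R - ε ≤ Real.logb 2 M / n ∧
    ∃ c : C.Code M n, ∀ m, c.errorProb P B₁ E m ≤ ε

/-- The capacity: the supremum of the achievable rates. -/
noncomputable def capacity : EReal :=
  sSup ((fun R : ℝ => (R : EReal)) '' {R | C.Achievable P B₁ E R})

end

/-- Mutual information (in bits) between the input, of law `p`, and the output of the finite
channel `Q(b | a)`. Terms with `p a * Q a b = 0` vanish, as usual. -/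
noncomputable def mutualInfo {α β : Type*} [Fintype α] [Fintype β] (p : α → ℝ) (Q : α → β → ℝ) :
    ℝ :=
  ∑ a, ∑ b, p a * Q a b * Real.logb 2 (Q a b / ∑ a', p a' * Q a' b)

section

variable {X Y : Type*} [Zero X] [Finite X] [Fintype Y] (C : EHChannel X Y)
  {Ω : Type*} [MeasurableSpace Ω] (P : Measure Ω) (E : ℕ → Ω → C.harvest)

/-- All values of `(1/N) I(U^N; Y^N | B₁ = 0)`, as the law of `U^N` ranges over all probability
distributions on the input alphabet of block length `N`. -/
def blockRates (N : ℕ) : Set ℝ :=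
  (fun p : C.Input N → ℝ =>
    1 / (N : ℝ) * mutualInfo p (fun u y => C.transitionGiven P E 0 u y)) ''
      stdSimplex ℝ (C.Input N)

/-- The largest normalized block mutual information given an empty initial battery. -/
noncomputable def lowerRate (N : ℕ) : ℝ := sSup (C.blockRates P E N)

end

end EHChannel

/-! Extra stored energy never hurts, so a strategy designed for an empty battery stays feasible at
every true level (`battery_mono`, `EnergyOK.mono`). Strategies for successive blocks can therefore
be concatenated, each later block pretending that its battery starts empty (`Input.append`).
Ignoring the true level wastes some opportunities but decouples the blocks: the harvested energies
are i.i.d., so the output law factors (`transitionGiven_append`). Blocks of length N then form a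
finite memoryless channel with input letters in `C.Input N`.

Achievability is the ordinary coding theorem for this block channel (`eventually_exists_code`),
obtained from Feinstein's greedy construction and a Chernoff bound on the information density.
Channel uses left over after the last full block are idle, and `Simulates` transfers the code back.

The maximum exists because mutual information is continuous on the compact simplex. The same
factorisation makes N times the lower rate superadditive, since independent optimal inputs for two
blocks add their informations; as the rate is at most log |Y|, Fekete's lemma gives the limit and
identifies it with the supremum. -/

namespace EHChannel

/-! ### Coding theorem for finite memoryless channels. -/

section Information

variable {A A' B B' : Type*} [Fintype A] [Fintype A'] [Fintype B] [Fintype B']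

/-- Feinstein's greedy construction of codewords with disjoint decoding sets. -/
theorem exists_decodingSets {p : A → ℝ} (hp : p ∈ stdSimplex ℝ A) {Q : A → B → ℝ}
    (hQ0 : ∀ a b, 0 ≤ Q a b) (hQ1 : ∀ a, ∑ b, Q a b = 1) {T ε : ℝ} (hT : 0 < T) {M : ℕ}
    (h : ∑ a, ∑ b with Q a b ≤ T * ∑ a', p a' * Q a' b, p a * Q a b + M / T ≤ ε) :
    ∀ k ≤ M, ∃ (enc : Fin k → A) (S : Fin k → Finset B),
      (∀ i j, i ≠ j → Disjoint (S i) (S j)) ∧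
      (∀ m, ∀ b ∈ S m, T * ∑ a', p a' * Q a' b ≤ Q (enc m) b) ∧
      ∀ m, 1 - ε ≤ ∑ b ∈ S m, Q (enc m) b := by
  classical
  intro k
  induction k with
  | zero => exact fun _ => ⟨Fin.elim0, Fin.elim0, fun i => i.elim0, fun i => i.elim0,
      fun i => i.elim0⟩
  | succ k ih =>
    intro hk
    obtain ⟨enc, S, hd, hS, he⟩ := ih (by omega)
    set q : B → ℝ := fun b => ∑ a', p a' * Q a' b with hq
    let U : Finset B := Finset.univ.biUnion S
    -- On each decoding set the output law q is at most 1/T times a conditional law, so the set has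
    -- q-mass at most 1/T. The hypothesis involves the final size M, hence one bound serves at every
    -- stage of the induction.
    have hU : ∑ b ∈ U, q b ≤ M / T := by
      have h1 : ∑ b ∈ U, q b = ∑ m, ∑ b ∈ S m, q b :=
        Finset.sum_biUnion fun i _ j _ hij => hd i j hij
      have h2 : ∀ m, ∑ b ∈ S m, q b ≤ 1 / T := by
        intro m
        rw [le_div_iff₀ hT, mul_comm, Finset.mul_sum]
        calc ∑ b ∈ S m, T * q b ≤ ∑ b ∈ S m, Q (enc m) b := Finset.sum_le_sum (hS m)
          _ ≤ ∑ b, Q (enc m) b :=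
            Finset.sum_le_univ_sum_of_nonneg fun b => hQ0 _ b
          _ = 1 := hQ1 _
      calc ∑ b ∈ U, q b ≤ ∑ _m : Fin k, 1 / T := h1 ▸ Finset.sum_le_sum fun m _ => h2 m
        _ = k / T := by simp [div_eq_mul_inv]
        _ ≤ M / T := by gcongr; omega
    -- Outputs of high information density that are not yet used. Averaged over p, the conditional
    -- mass of `U` is its q-mass, so `F` has average mass at least 1 - ε and some letter qualifies
    -- as the next codeword.
    let F : A → Finset B := fun a => Finset.univ.filter (fun b => ¬ Q a b ≤ T * q b) \ U
    have hF : ∀ a, 1 ≤ ∑ b ∈ F a, Q a b + ∑ b with Q a b ≤ T * q b, Q a b + ∑ b ∈ U, Q a b := by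
      intro a
      rw [← hQ1 a, ← Finset.sum_filter_not_add_sum_filter Finset.univ (fun b => Q a b ≤ T * q b)]
      have : ∑ b with ¬ Q a b ≤ T * q b, Q a b ≤ ∑ b ∈ F a, Q a b + ∑ b ∈ U, Q a b := by
        rw [← Finset.sum_union Finset.sdiff_disjoint, Finset.sdiff_union_self_eq_union]
        exact Finset.sum_le_sum_of_subset_of_nonneg Finset.subset_union_left
          fun b _ _ => hQ0 a b
      linarith
    have hsum : 1 - ε ≤ ∑ a, p a * ∑ b ∈ F a, Q a b := by
      have h1 : ∑ a, p a * 1 ≤ ∑ a, p a * (∑ b ∈ F a, Q a b + ∑ b with Q a b ≤ T * q b, Q a b +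
          ∑ b ∈ U, Q a b) := Finset.sum_le_sum fun a _ => mul_le_mul_of_nonneg_left (hF a) (hp.1 a)
      have h2 : ∑ a, p a * ∑ b ∈ U, Q a b = ∑ b ∈ U, q b := by
        simp_rw [Finset.mul_sum, hq]
        exact Finset.sum_comm
      simp_rw [mul_add, Finset.sum_add_distrib, h2, mul_one, hp.2] at h1
      simp_rw [Finset.mul_sum] at h1 ⊢
      linarith
    obtain ⟨a, ha⟩ : ∃ a, 1 - ε ≤ ∑ b ∈ F a, Q a b := by
      by_contra! hcon
      obtain ⟨a₀, ha₀⟩ : ∃ a, 0 < p a := by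
        by_contra! hc
        have := Finset.sum_nonpos fun a (_ : a ∈ Finset.univ) => hc a
        rw [hp.2] at this
        linarith
      have : ∑ a, p a * ∑ b ∈ F a, Q a b < ∑ a, p a * (1 - ε) :=
        Finset.sum_lt_sum (fun a _ => mul_le_mul_of_nonneg_left (hcon a).le (hp.1 a))
          ⟨a₀, Finset.mem_univ _, mul_lt_mul_of_pos_left (hcon a₀) ha₀⟩
      rw [← Finset.sum_mul, hp.2] at this
      linarith
    have hFU : ∀ m, Disjoint (F a) (S m) := fun m =>
      Finset.disjoint_of_subset_right (Finset.subset_biUnion_of_mem S (Finset.mem_univ m))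
        Finset.sdiff_disjoint
    refine ⟨Fin.cons a enc, Fin.cons (F a) S, ?_, ?_, ?_⟩
    · intro i j
      refine Fin.cases ?_ (fun i => ?_) i <;> refine Fin.cases ?_ (fun j => ?_) j
      · simp
      · intro _; simpa using hFU j
      · intro _; simpa using (hFU i).symm
      · intro hij; simpa using hd i j (fun h => hij (by rw [h]))
    · intro m
      refine Fin.cases ?_ (fun m => ?_) m
      · intro b hb
        simp only [Fin.cons_zero, F, Finset.mem_sdiff, Finset.mem_filter, not_le] at hb ⊢
        exact hb.1.2.le
      · simpa using hS m
    · intro m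
      refine Fin.cases ?_ (fun m => ?_) m
      · simpa using ha
      · simpa using he m

/-- Feinstein's lemma. -/
theorem exists_code_of_sum_le {p : A → ℝ} (hp : p ∈ stdSimplex ℝ A) {Q : A → B → ℝ}
    (hQ0 : ∀ a b, 0 ≤ Q a b) (hQ1 : ∀ a, ∑ b, Q a b = 1) {T ε : ℝ} (hT : 0 < T) {M : ℕ}
    (hM : 1 ≤ M)
    (h : ∑ a, ∑ b with Q a b ≤ T * ∑ a', p a' * Q a' b, p a * Q a b + M / T ≤ ε) :
    ∃ (enc : Fin M → A) (dec : B → Fin M), ∀ m, ∑ b with dec b ≠ m, Q (enc m) b ≤ ε := by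
  classical
  obtain ⟨enc, S, hd, -, he⟩ := exists_decodingSets hp hQ0 hQ1 hT h M le_rfl
  refine ⟨enc, fun b => if hb : ∃ m, b ∈ S m then hb.choose else ⟨0, hM⟩, fun m => ?_⟩
  have hdec : ∀ b ∈ S m, (if hb : ∃ m, b ∈ S m then hb.choose else ⟨0, hM⟩) = m := by
    intro b hb
    have hex : ∃ m, b ∈ S m := ⟨m, hb⟩
    rw [dif_pos hex]
    by_contra hne
    exact Finset.disjoint_left.1 (hd _ _ hne) hex.choose_spec hb
  have hsub : Finset.univ.filter (fun b => (if hb : ∃ m, b ∈ S m then hb.choose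
      else ⟨0, hM⟩) ≠ m) ⊆ (S m)ᶜ := by
    intro b hb
    rw [Finset.mem_compl]
    exact fun hbS => (Finset.mem_filter.1 hb).2 (hdec b hbS)
  calc _ ≤ ∑ b ∈ (S m)ᶜ, Q (enc m) b :=
        Finset.sum_le_sum_of_subset_of_nonneg hsub fun b _ _ => hQ0 _ b
    _ ≤ ε := by
      have := Finset.sum_add_sum_compl (S m) (Q (enc m))
      rw [hQ1] at this
      linarith [he m]

theorem output_pos {A B : Type*} [Fintype A] {p : A → ℝ} (hp : ∀ a, 0 ≤ p a) {Q : A → B → ℝ} (hQ0 : ∀ a b, 0 ≤ Q a b)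
    {a : A} {b : B} (h : p a * Q a b ≠ 0) : 0 < ∑ a', p a' * Q a' b :=
  (lt_of_le_of_ne (mul_nonneg (hp a) (hQ0 a b)) h.symm).trans_le
    (Finset.single_le_sum (f := fun a' => p a' * Q a' b)
      (fun a' _ => mul_nonneg (hp a') (hQ0 a' b)) (Finset.mem_univ a))

/-- The Chernoff function of the information density is below one somewhere on the right of zero,
as long as the threshold is below the mutual information. -/
theorem exists_chernoff_lt_one {p : A → ℝ} (hp : p ∈ stdSimplex ℝ A) {Q : A → B → ℝ}
    (hQ0 : ∀ a b, 0 ≤ Q a b) (hQ1 : ∀ a, ∑ b, Q a b = 1) {t : ℝ} (ht : 0 < t)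
    (htI : Real.logb 2 t < mutualInfo p Q) :
    ∃ s > 0, ∑ a, ∑ b, p a * Q a b * (t * (∑ a', p a' * Q a' b) / Q a b) ^ (s : ℝ) < 1 := by
  set q : B → ℝ := fun b => ∑ a', p a' * Q a' b with hq
  set f : ℝ → ℝ := fun s => ∑ a, ∑ b, p a * Q a b * (t * q b / Q a b) ^ s with hf
  have hsum : ∑ a, ∑ b, p a * Q a b = 1 := by
    simp_rw [← Finset.mul_sum, hQ1, mul_one, hp.2]
  have hf0 : f 0 = 1 := by simp [hf, hsum]
  -- The slope at 0 is log 2 times the gap between `Real.logb 2 t` and the mutual information, hence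
  -- negative, while f 0 = 1. Pairs of zero mass contribute the zero function; for the others the
  -- base of the power is positive.
  have hder : HasDerivAt f (∑ a, ∑ b, p a * Q a b * Real.log (t * q b / Q a b)) 0 := by
    refine HasDerivAt.fun_sum fun a _ => HasDerivAt.fun_sum fun b _ => ?_
    by_cases h : p a * Q a b = 0
    · simpa [h] using hasDerivAt_const (0 : ℝ) (0 : ℝ)
    · have hQ : 0 < Q a b := lt_of_le_of_ne (hQ0 a b) fun h' => h (by simp [← h'])
      have hpos : 0 < t * q b / Q a b := div_pos (mul_pos ht (output_pos hp.1 hQ0 h)) hQ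
      have := ((hasDerivAt_id (0 : ℝ)).const_rpow hpos).const_mul (p a * Q a b)
      simpa using this
  have hval : ∑ a, ∑ b, p a * Q a b * Real.log (t * q b / Q a b)
      = Real.log t - mutualInfo p Q * Real.log 2 := by
    have h1 : Real.log t = ∑ a, ∑ b, p a * Q a b * Real.log t := by
      simp_rw [← Finset.sum_mul, hsum, one_mul]
    rw [h1, mutualInfo]
    simp_rw [Finset.sum_mul, ← Finset.sum_sub_distrib]
    refine Finset.sum_congr rfl fun a _ => Finset.sum_congr rfl fun b _ => ?_
    by_cases h : p a * Q a b = 0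
    · simp [h]
    · have hQ : 0 < Q a b := lt_of_le_of_ne (hQ0 a b) fun h' => h (by simp [← h'])
      have hqb : 0 < q b := output_pos hp.1 hQ0 h
      have hl : Real.log 2 ≠ 0 := (Real.log_pos one_lt_two).ne'
      rw [Real.log_div (mul_pos ht hqb).ne' hQ.ne', Real.log_mul ht.ne' hqb.ne', Real.logb,
        mul_assoc (p a * Q a b), div_mul_cancel₀ _ hl, Real.log_div hQ.ne' hqb.ne']
      ring
  have hneg : ∑ a, ∑ b, p a * Q a b * Real.log (t * q b / Q a b) < 0 := by
    rw [hval]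
    rw [Real.logb, div_lt_iff₀ (Real.log_pos one_lt_two)] at htI
    linarith
  have hev := (hder.tendsto_slope.mono_left
    (nhdsWithin_mono (0 : ℝ) (fun x (hx : x ∈ Set.Ioi 0) => (ne_of_gt hx)))).eventually_lt_const
    hneg
  obtain ⟨s, hs, hs0⟩ := (hev.and self_mem_nhdsWithin).exists
  refine ⟨s, hs0, ?_⟩
  rw [slope_def_field, hf0, sub_zero, div_neg_iff] at hs
  have hs0' : (0 : ℝ) < s := hs0
  change f s < 1
  rcases hs with hs | hs
  · linarith [hs.2]
  · linarith [hs.1]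

theorem output_pi {A B : Type*} [Fintype A] {K : ℕ} (p : A → ℝ) (Q : A → B → ℝ) (z : Fin K → B) :
    ∑ a : Fin K → A, (∏ k, p (a k)) * ∏ k, Q (a k) (z k) = ∏ k, ∑ a, p a * Q a (z k) := by
  classical
  simp_rw [← Finset.prod_mul_distrib]
  rw [Finset.prod_univ_sum, Fintype.piFinset_univ]

theorem pi_mem_stdSimplex {K : ℕ} {p : A → ℝ} (hp : p ∈ stdSimplex ℝ A) :
    (fun a : Fin K → A => ∏ k, p (a k)) ∈ stdSimplex ℝ (Fin K → A) := by
  classical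
  refine ⟨fun a => Finset.prod_nonneg fun k _ => hp.1 _, ?_⟩
  have := Finset.prod_univ_sum (fun _ : Fin K => (Finset.univ : Finset A)) fun _ a => p a
  rw [Fintype.piFinset_univ] at this
  rw [← this]
  simp [hp.2]

/-- Chernoff bound for the information density of a memoryless channel. -/
theorem sum_informationDensity_le {p : A → ℝ} (hp : p ∈ stdSimplex ℝ A) {Q : A → B → ℝ}
    (hQ0 : ∀ a b, 0 ≤ Q a b) {t s : ℝ} (ht : 0 < t) (hs : 0 < s) (K : ℕ) :
    ∑ a : Fin K → A, ∑ z : Fin K → B with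
        ∏ k, Q (a k) (z k) ≤ t ^ K * ∑ a' : Fin K → A, (∏ k, p (a' k)) * ∏ k, Q (a' k) (z k),
      (∏ k, p (a k)) * ∏ k, Q (a k) (z k) ≤
    (∑ a, ∑ b, p a * Q a b * (t * (∑ a', p a' * Q a' b) / Q a b) ^ (s : ℝ)) ^ K := by
  classical
  set q : B → ℝ := fun b => ∑ a', p a' * Q a' b with hq
  have hq0 : ∀ b, 0 ≤ q b := fun b =>
    Finset.sum_nonneg fun a _ => mul_nonneg (hp.1 a) (hQ0 a b)
  have hw0 : ∀ a b, 0 ≤ t * q b / Q a b := fun a b =>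
    div_nonneg (mul_nonneg ht.le (hq0 b)) (hQ0 a b)
  have hg0 : ∀ a b, 0 ≤ p a * Q a b * (t * q b / Q a b) ^ (s : ℝ) := fun a b =>
    mul_nonneg (mul_nonneg (hp.1 a) (hQ0 a b)) (Real.rpow_nonneg (hw0 a b) _)
  have hR : (∑ a, ∑ b, p a * Q a b * (t * q b / Q a b) ^ (s : ℝ)) ^ K =
      ∑ a : Fin K → A, ∑ z : Fin K → B,
        ∏ k, (p (a k) * Q (a k) (z k) * (t * q (z k) / Q (a k) (z k)) ^ (s : ℝ)) := by
    have h1 : ∀ a : Fin K → A, ∑ z : Fin K → B,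
        ∏ k, (p (a k) * Q (a k) (z k) * (t * q (z k) / Q (a k) (z k)) ^ (s : ℝ)) =
        ∏ k, ∑ b, p (a k) * Q (a k) b * (t * q b / Q (a k) b) ^ (s : ℝ) := fun a => by
      rw [Finset.prod_univ_sum, Fintype.piFinset_univ]
    simp_rw [h1]
    have h2 := Finset.prod_univ_sum (fun _ : Fin K => (Finset.univ : Finset A))
      fun _ a => ∑ b, p a * Q a b * (t * q b / Q a b) ^ (s : ℝ)
    rw [Fintype.piFinset_univ] at h2
    rw [← h2]
    simp
  rw [hR]
  refine Finset.sum_le_sum fun a _ => ?_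
  refine le_trans (Finset.sum_le_sum fun z hz => ?_)
    (Finset.sum_le_univ_sum_of_nonneg fun z => Finset.prod_nonneg fun k _ => hg0 _ _)
  have hz' := (Finset.mem_filter.1 hz).2
  rw [output_pi] at hz'
  rw [Finset.prod_mul_distrib, Finset.prod_mul_distrib]
  have hpQ : 0 ≤ (∏ k, p (a k)) * ∏ k, Q (a k) (z k) :=
    mul_nonneg (Finset.prod_nonneg fun k _ => hp.1 _) (Finset.prod_nonneg fun k _ => hQ0 _ _)
  rcases (Finset.prod_nonneg fun k (_ : k ∈ Finset.univ) => hQ0 (a k) (z k)).eq_or_lt with h0 | h0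
  · simp [← h0]
  -- Markov's inequality in exponential form: on the event summed over, the product of the ratios t
  -- q / Q is at least 1, hence so is its s-th power.
  · refine le_mul_of_one_le_right hpQ ?_
    rw [Real.finsetProd_rpow _ _ fun k _ => hw0 _ _]
    refine Real.one_le_rpow ?_ hs.le
    rw [Finset.prod_div_distrib, one_le_div h0, Finset.prod_mul_distrib]
    simpa using hz'

/-- Achievability part of the channel coding theorem for a finite memoryless channel, with maximal
error probability. -/
theorem eventually_exists_code {p : A → ℝ} (hp : p ∈ stdSimplex ℝ A) {Q : A → B → ℝ}
    (hQ0 : ∀ a b, 0 ≤ Q a b) (hQ1 : ∀ a, ∑ b, Q a b = 1) {r : ℝ} (hr : 0 < r)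
    (hrI : r < mutualInfo p Q) {ε : ℝ} (hε : 0 < ε) :
    ∀ᶠ K : ℕ in atTop, ∃ M : ℕ, 1 ≤ M ∧ K * r ≤ Real.logb 2 M ∧
      ∃ (enc : Fin M → Fin K → A) (dec : (Fin K → B) → Fin M),
        ∀ m, ∑ z with dec z ≠ m, ∏ k, Q (enc m k) (z k) ≤ ε := by
  -- Two gaps are needed: r < r' makes the number of messages negligible against the threshold t ^
  -- K, and r' < I makes the low-density event exponentially rare.
  obtain ⟨r', hr', hrI'⟩ := exists_between hrI
  set t : ℝ := 2 ^ r' with htdef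
  set τ : ℝ := 2 ^ r with hτdef
  have ht : 0 < t := by positivity
  have hτ : 0 < τ := by positivity
  have ht1 : 1 < t := Real.one_lt_rpow one_lt_two (hr.trans hr')
  have hτt : τ < t := Real.rpow_lt_rpow_of_exponent_lt one_lt_two hr'
  obtain ⟨s, hs, hρ⟩ := exists_chernoff_lt_one hp hQ0 hQ1 ht
    (by rwa [htdef, Real.logb_rpow two_pos (by norm_num)])
  set ρ := ∑ a, ∑ b, p a * Q a b * (t * (∑ a', p a' * Q a' b) / Q a b) ^ (s : ℝ) with hρdef
  have hρ0 : 0 ≤ ρ := Finset.sum_nonneg fun a _ => Finset.sum_nonneg fun b _ =>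
    mul_nonneg (mul_nonneg (hp.1 a) (hQ0 a b)) (Real.rpow_nonneg (div_nonneg (mul_nonneg ht.le
      (Finset.sum_nonneg fun a _ => mul_nonneg (hp.1 a) (hQ0 a b))) (hQ0 a b)) _)
  have hlim : Tendsto (fun K : ℕ => ρ ^ K + ((τ / t) ^ K + (1 / t) ^ K)) atTop (𝓝 0) := by
    have h1 := tendsto_pow_atTop_nhds_zero_of_lt_one hρ0 hρ
    have h2 := tendsto_pow_atTop_nhds_zero_of_lt_one (div_nonneg hτ.le ht.le)
      ((div_lt_one ht).2 hτt)
    have h3 := tendsto_pow_atTop_nhds_zero_of_lt_one (div_nonneg zero_le_one ht.le)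
      ((div_lt_one ht).2 ht1)
    simpa using h1.add (h2.add h3)
  filter_upwards [hlim.eventually_le_const hε] with K hK
  have hM : 1 ≤ ⌈τ ^ K⌉₊ := Nat.one_le_iff_ne_zero.2 (Nat.ceil_pos.2 (pow_pos hτ K)).ne'
  refine ⟨⌈τ ^ K⌉₊, hM, ?_, ?_⟩
  · have : Real.logb 2 (τ ^ K) = K * r := by
      rw [Real.logb_pow, hτdef, Real.logb_rpow two_pos (by norm_num)]
    rw [← this]
    exact Real.logb_le_logb_of_le one_lt_two (pow_pos hτ K) (Nat.le_ceil _)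
  · refine exists_code_of_sum_le (pi_mem_stdSimplex hp)
      (Q := fun (a : Fin K → A) (z : Fin K → B) => ∏ k, Q (a k) (z k))
      (fun a z => Finset.prod_nonneg fun k _ => hQ0 _ _) (fun a => ?_) (pow_pos ht K) hM ?_
    · classical
      have := Finset.prod_univ_sum (fun _ : Fin K => (Finset.univ : Finset B)) fun k b => Q (a k) b
      rw [Fintype.piFinset_univ] at this
      rw [← this]
      simp [hQ1]
    · refine le_trans (add_le_add (sum_informationDensity_le hp hQ0 ht hs K) ?_) hK
      -- The ceiling in M costs at most 1, which is the source of the term (1 / t) ^ K; it vanishes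
      -- because r > 0 forces t > 1.
      rw [div_pow, div_pow, one_pow, ← add_div]
      gcongr
      exact (Nat.ceil_lt_add_one (pow_pos hτ K).le).le

/-! ### Continuity, boundedness and additivity of mutual information. -/

theorem mutualInfo_eq {p : A → ℝ} (hp : ∀ a, 0 ≤ p a) {Q : A → B → ℝ}
    (hQ0 : ∀ a b, 0 ≤ Q a b) :
    mutualInfo p Q = ∑ a, ∑ b, p a * Q a b * Real.logb 2 (Q a b) -
      ∑ b, (∑ a, p a * Q a b) * Real.logb 2 (∑ a, p a * Q a b) := by
  simp_rw [Finset.sum_mul]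
  rw [Finset.sum_comm (s := (Finset.univ : Finset B)), ← Finset.sum_sub_distrib, mutualInfo]
  refine Finset.sum_congr rfl fun a _ => ?_
  rw [← Finset.sum_sub_distrib]
  refine Finset.sum_congr rfl fun b _ => ?_
  by_cases h : p a * Q a b = 0
  · simp [h]
  · rw [Real.logb_div (right_ne_zero_of_mul h) (output_pos hp hQ0 h).ne']
    ring

/-- In the entropy form, p enters linearly or through x log x, which is continuous at 0; the
quotient in the definition hides this. -/
theorem continuousOn_mutualInfo {Q : A → B → ℝ} (hQ0 : ∀ a b, 0 ≤ Q a b) :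
    ContinuousOn (fun p : A → ℝ => mutualInfo p Q) (stdSimplex ℝ A) := by
  have hc : Continuous fun p : A → ℝ => ∑ a, ∑ b, p a * Q a b * Real.logb 2 (Q a b) -
      ∑ b, (∑ a, p a * Q a b) * Real.logb 2 (∑ a, p a * Q a b) := by
    have hl : Continuous fun x : ℝ => x * Real.logb 2 x := by
      simp_rw [Real.logb, ← mul_div_assoc]
      exact Real.continuous_mul_log.div_const _
    refine Continuous.sub (by fun_prop) (continuous_finsetSum _ fun b _ => ?_)
    exact hl.comp (f := fun p : A → ℝ => ∑ a, p a * Q a b) (by fun_prop)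
  exact hc.continuousOn.congr fun p hp => mutualInfo_eq hp.1 hQ0

/-- Mutual information is at most the output entropy, because log Q ≤ 0; the entropy is bounded via
log x ≤ x - 1 at x = 1 / (q b |B|). -/
theorem mutualInfo_le_logb_card {p : A → ℝ} (hp : p ∈ stdSimplex ℝ A) {Q : A → B → ℝ}
    (hQ0 : ∀ a b, 0 ≤ Q a b) (hQ1 : ∀ a, ∑ b, Q a b = 1) :
    mutualInfo p Q ≤ Real.logb 2 (Fintype.card B) := by
  set q : B → ℝ := fun b => ∑ a, p a * Q a b with hq
  have hq0 : ∀ b, 0 ≤ q b := fun b =>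
    Finset.sum_nonneg fun a _ => mul_nonneg (hp.1 a) (hQ0 a b)
  have hq1 : ∑ b, q b = 1 := by
    rw [hq, Finset.sum_comm]
    simp_rw [← Finset.mul_sum, hQ1, mul_one, hp.2]
  have hl2 : 0 < Real.log 2 := Real.log_pos one_lt_two
  rcases isEmpty_or_nonempty B with hB | hB
  · simp at hq1
  have hn : (0 : ℝ) < Fintype.card B := by exact_mod_cast Fintype.card_pos
  have h1 : ∑ a, ∑ b, p a * Q a b * Real.logb 2 (Q a b) ≤ 0 :=
    Finset.sum_nonpos fun a _ => Finset.sum_nonpos fun b _ =>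
      mul_nonpos_of_nonneg_of_nonpos (mul_nonneg (hp.1 a) (hQ0 a b))
        (Real.logb_nonpos one_lt_two (hQ0 a b)
          (hQ1 a ▸ Finset.single_le_sum (fun b _ => hQ0 a b) (Finset.mem_univ b)))
  have h2 : ∀ b, -(q b * Real.log (q b)) - q b * Real.log (Fintype.card B) ≤
      (Fintype.card B : ℝ)⁻¹ - q b := by
    intro b
    rcases (hq0 b).eq_or_lt with h | h
    · rw [← h]; simp
    · have h3 := Real.log_le_sub_one_of_pos (inv_pos.2 (mul_pos h hn))
      rw [Real.log_inv, Real.log_mul h.ne' hn.ne'] at h3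
      have h4 := mul_le_mul_of_nonneg_left h3 h.le
      have h5 : q b * ((q b * Fintype.card B)⁻¹ - 1) = (Fintype.card B : ℝ)⁻¹ - q b := by
        field_simp
      rw [h5] at h4
      linarith
  have h3 := Finset.sum_le_sum fun b (_ : b ∈ Finset.univ) => h2 b
  rw [Finset.sum_sub_distrib, Finset.sum_sub_distrib, Finset.sum_neg_distrib, ← Finset.sum_mul,
    hq1, Finset.sum_const, Finset.card_univ, nsmul_eq_mul, mul_inv_cancel₀ hn.ne'] at h3
  have h4 : ∑ b, q b * Real.logb 2 (q b) = (∑ b, q b * Real.log (q b)) / Real.log 2 := by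
    simp_rw [Real.logb, Finset.sum_div, mul_div_assoc]
  rw [mutualInfo_eq hp.1 hQ0]
  change _ - ∑ b, q b * Real.logb 2 (q b) ≤ _
  rw [h4, Real.logb]
  have h5 : -(∑ b, q b * Real.log (q b)) / Real.log 2 ≤
      Real.log (Fintype.card B) / Real.log 2 := by
    gcongr
    linarith
  rw [neg_div] at h5
  linarith

/-- Mutual information does not change when the input is pushed forward. -/
theorem mutualInfo_map [DecidableEq A'] (f : A → A') (p : A → ℝ) (Q : A' → B → ℝ) :
    mutualInfo (fun a' => ∑ a with f a = a', p a) Q = mutualInfo p fun a => Q (f a) := by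
  have key : ∀ g : A' → ℝ, ∑ a', (∑ a with f a = a', p a) * g a' = ∑ a, p a * g (f a) := by
    intro g
    rw [← Finset.sum_fiberwise_of_maps_to (s := Finset.univ) (t := Finset.univ) (g := f)
      (fun _ _ => Finset.mem_univ _)]
    refine Finset.sum_congr rfl fun a' _ => ?_
    rw [Finset.sum_mul]
    refine Finset.sum_congr rfl fun a ha => ?_
    rw [(Finset.mem_filter.1 ha).2]
  simp_rw [mutualInfo, key, mul_assoc, ← Finset.mul_sum]
  exact key fun a' => ∑ b, Q a' b * Real.logb 2 (Q a' b / ∑ a, p a * Q (f a) b)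

theorem mutualInfo_comp_equiv (g : B ≃ B') (p : A → ℝ) (Q : A → B' → ℝ) :
    (mutualInfo p fun a b => Q a (g b)) = mutualInfo p Q :=
  Finset.sum_congr rfl fun a _ => g.sum_comp fun b =>
    p a * Q a b * Real.logb 2 (Q a b / ∑ a', p a' * Q a' b)

/-- The output law factors, so the logarithm splits wherever the mass is nonzero, and the factor
without a logarithm sums to 1. -/
theorem mutualInfo_prod {p : A → ℝ} (hp : p ∈ stdSimplex ℝ A) {p' : A' → ℝ}
    (hp' : p' ∈ stdSimplex ℝ A') {Q : A → B → ℝ} (hQ0 : ∀ a b, 0 ≤ Q a b)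
    (hQ1 : ∀ a, ∑ b, Q a b = 1) {Q' : A' → B' → ℝ} (hQ0' : ∀ a b, 0 ≤ Q' a b)
    (hQ1' : ∀ a, ∑ b, Q' a b = 1) :
    (mutualInfo (fun a : A × A' => p a.1 * p' a.2)
      fun a (b : B × B') => Q a.1 b.1 * Q' a.2 b.2) = mutualInfo p Q + mutualInfo p' Q' := by
  have hout : ∀ b : B × B', ∑ a : A × A', p a.1 * p' a.2 * (Q a.1 b.1 * Q' a.2 b.2) =
      (∑ a, p a * Q a b.1) * ∑ a, p' a * Q' a b.2 := by
    intro b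
    rw [Fintype.sum_mul_sum, Fintype.sum_prod_type]
    refine Finset.sum_congr rfl fun a _ => Finset.sum_congr rfl fun a' _ => by ring
  have hterm : ∀ (a : A × A') (b : B × B'),
      p a.1 * p' a.2 * (Q a.1 b.1 * Q' a.2 b.2) * Real.logb 2 (Q a.1 b.1 * Q' a.2 b.2 /
        ((∑ a, p a * Q a b.1) * ∑ a, p' a * Q' a b.2)) =
      (p a.1 * Q a.1 b.1 * Real.logb 2 (Q a.1 b.1 / ∑ a, p a * Q a b.1)) *
        (p' a.2 * Q' a.2 b.2) + (p a.1 * Q a.1 b.1) *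
        (p' a.2 * Q' a.2 b.2 * Real.logb 2 (Q' a.2 b.2 / ∑ a, p' a * Q' a b.2)) := by
    intro a b
    have hrw : p a.1 * p' a.2 * (Q a.1 b.1 * Q' a.2 b.2) =
      (p a.1 * Q a.1 b.1) * (p' a.2 * Q' a.2 b.2) := by ring
    rw [hrw]
    by_cases h : p a.1 * Q a.1 b.1 = 0
    · simp [h]
    by_cases h' : p' a.2 * Q' a.2 b.2 = 0
    · simp [h']
    rw [mul_div_mul_comm, Real.logb_mul
      (div_ne_zero (right_ne_zero_of_mul h) (output_pos hp.1 hQ0 h).ne')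
      (div_ne_zero (right_ne_zero_of_mul h') (output_pos hp'.1 hQ0' h').ne')]
    ring
  have hs : ∑ a, ∑ b, p a * Q a b = 1 := by simp_rw [← Finset.mul_sum, hQ1, mul_one, hp.2]
  have hs' : ∑ a, ∑ b, p' a * Q' a b = 1 := by simp_rw [← Finset.mul_sum, hQ1', mul_one, hp'.2]
  have hprod : ∀ (F : A → B → ℝ) (G : A' → B' → ℝ),
      ∑ a : A × A', ∑ b : B × B', F a.1 b.1 * G a.2 b.2 = (∑ a, ∑ b, F a b) * ∑ a, ∑ b, G a b := by
    intro F G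
    rw [Fintype.sum_mul_sum, Fintype.sum_prod_type]
    refine Finset.sum_congr rfl fun a _ => Finset.sum_congr rfl fun a' _ => ?_
    rw [Fintype.sum_mul_sum, Fintype.sum_prod_type]
  simp_rw [mutualInfo, hout, hterm, Finset.sum_add_distrib]
  rw [hprod (fun a b => p a * Q a b * Real.logb 2 (Q a b / ∑ a, p a * Q a b))
    (fun a b => p' a * Q' a b), hprod (fun a b => p a * Q a b)
    (fun a b => p' a * Q' a b * Real.logb 2 (Q' a b / ∑ a, p' a * Q' a b)), hs, hs', mul_one,
    one_mul]

end Information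

end EHChannel

namespace EHChannel

/-! ### Monotonicity of the battery and concatenation of strategies. -/

section Battery

variable {X Y : Type*} [Zero X] [Fintype Y] (C : EHChannel X Y)

theorem battery_succ {N : ℕ} (b : Fin (C.cap + 1)) (e : Fin N → C.harvest) (x : Fin N → X)
    {n : ℕ} (h : n < N) :
    (C.battery b e x (n + 1) : ℕ) =
      min (C.avail (C.battery b e x n) (e ⟨n, h⟩) - C.cost (x ⟨n, h⟩)) C.cap := by
  simp [battery, h]

/-- A fuller initial battery leads to fuller batteries at all times. -/
theorem battery_mono (hmono : ∀ e, Monotone fun b => C.avail b e) {N : ℕ}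
    (e : Fin N → C.harvest) (x : Fin N → X) (n : ℕ) :
    Monotone fun b => C.battery b e x n := by
  intro b b' hb
  induction n with
  | zero => exact hb
  | succ n ih =>
    by_cases h : n < N
    · change (C.battery b e x (n + 1) : ℕ) ≤ (C.battery b' e x (n + 1) : ℕ)
      rw [battery_succ C b e x h, battery_succ C b' e x h]
      exact min_le_min_right _ (Nat.sub_le_sub_right (hmono _ ih) _)
    · simpa [battery, h] using ih

theorem EnergyOK.mono (hmono : ∀ e, Monotone fun b => C.avail b e) {N : ℕ}
    {b b' : Fin (C.cap + 1)} (hb : b ≤ b') {e : Fin N → C.harvest} {x : Fin N → X}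
    (h : C.EnergyOK b e x) : C.EnergyOK b' e x := fun n =>
  (h n).trans (hmono _ (C.battery_mono hmono e x n hb))

theorem battery_append_left {N M : ℕ} (b : Fin (C.cap + 1)) (e : Fin (N + M) → C.harvest)
    (x : Fin N → X) (x' : Fin M → X) {n : ℕ} (hn : n ≤ N) :
    C.battery b e (Fin.append x x') n = C.battery b (fun i => e (Fin.castAdd M i)) x n := by
  induction n with
  | zero => rfl
  | succ n ih =>
    have h : n < N := hn
    ext
    rw [battery_succ C b e _ (h.trans_le (Nat.le_add_right N M)), battery_succ C b _ x h,
      ih h.le]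
    have hx : Fin.append x x' ⟨n, h.trans_le (Nat.le_add_right N M)⟩ = x ⟨n, h⟩ :=
      Fin.append_left x x' ⟨n, h⟩
    rw [hx]
    rfl

theorem battery_append_right {N M : ℕ} (b : Fin (C.cap + 1)) (e : Fin (N + M) → C.harvest)
    (x : Fin N → X) (x' : Fin M → X) {n : ℕ} (hn : n ≤ M) :
    C.battery b e (Fin.append x x') (N + n) =
      C.battery (C.battery b e (Fin.append x x') N) (fun i => e (Fin.natAdd N i)) x' n := by
  induction n with
  | zero => rfl
  | succ n ih =>
    have h : n < M := hn
    ext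
    rw [← Nat.add_assoc, battery_succ C b e _ (Nat.add_lt_add_left h N),
      battery_succ C _ _ x' h, ih h.le]
    have hx : Fin.append x x' ⟨N + n, Nat.add_lt_add_left h N⟩ = x' ⟨n, h⟩ :=
      Fin.append_right x x' ⟨n, h⟩
    rw [hx]
    rfl

/-- Whatever level the first block leaves is at least 0, so a second block affordable from an empty
battery remains affordable. -/
theorem EnergyOK.append (hmono : ∀ e, Monotone fun b => C.avail b e) {N M : ℕ}
    {b : Fin (C.cap + 1)} {e : Fin (N + M) → C.harvest} {x : Fin N → X} {x' : Fin M → X}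
    (h : C.EnergyOK b (fun i => e (Fin.castAdd M i)) x)
    (h' : C.EnergyOK 0 (fun i => e (Fin.natAdd N i)) x') :
    C.EnergyOK b e (Fin.append x x') := by
  intro n
  refine Fin.addCases (fun i => ?_) (fun i => ?_) n
  · rw [Fin.append_left]
    have := C.battery_append_left b e x x' i.2.le
    rw [Fin.val_castAdd, this]
    exact h i
  · rw [Fin.append_right]
    have := C.battery_append_right b e x x' i.2.le
    rw [Fin.val_natAdd, this]
    exact EnergyOK.mono C hmono (Fin.zero_le _) h' i

/-- The input that transmits the zero symbol only. -/
instance (N : ℕ) : Inhabited (C.Input N) :=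
  ⟨⟨fun _ _ _ => 0, fun _ _ _ _ _ => rfl, fun _ _ _ => by simp [C.cost_zero]⟩⟩

variable {C}

/-- The input that ignores the initial level and acts as if the battery were empty at first. -/
def Input.fromEmpty (hmono : ∀ e, Monotone fun b => C.avail b e) {N : ℕ} (u : C.Input N) :
    C.Input N :=
  ⟨fun _ => u.1 0, fun _ => u.2.1 0, fun b e =>
    EnergyOK.mono C hmono (Fin.zero_le b) (u.2.2 0 e)⟩

/-- The input that uses `u`, and then `v` as if the battery were empty at its start. -/
def Input.append (hmono : ∀ e, Monotone fun b => C.avail b e) {N M : ℕ} (u : C.Input N)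
    (v : C.Input M) : C.Input (N + M) :=
  ⟨fun b e => Fin.append (u.1 b fun i => e (Fin.castAdd M i)) (v.1 0 fun i => e (Fin.natAdd N i)),
    by
      intro b e e' n
      refine Fin.addCases (fun i h => ?_) (fun i h => ?_) n
      · simp only [Fin.append_left]
        exact u.2.1 b _ _ i fun j hj => h (Fin.castAdd M j) hj
      · simp only [Fin.append_right]
        exact v.2.1 0 _ _ i fun j hj => h (Fin.natAdd N j) (Nat.add_le_add_left hj N),
    fun b e => EnergyOK.append C hmono (u.2.2 b _) (v.2.2 0 _)⟩

end Battery

/-! ### Output laws and simulation of memoryless channels. -/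

section Transition

variable {X Y Ω : Type*} [Zero X] [Fintype Y] [MeasurableSpace Ω] {C : EHChannel X Y}
  {P : Measure Ω} {B₁ : Ω → Fin (C.cap + 1)} {E : ℕ → Ω → C.harvest}

/-- Such an input does not look at the initial level, so the sum over b only marginalises the
weights. -/
theorem transition_fromEmpty [IsFiniteMeasure P] (hmono : ∀ e, Monotone fun b => C.avail b e)
    (hB₁ : Measurable B₁) (hE : ∀ n, Measurable (E n)) {N : ℕ} (u : C.Input N) (y : Fin N → Y) :
    C.transition P B₁ E (u.fromEmpty hmono) y = C.transitionGiven P E 0 u y := by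
  rw [transition, Finset.sum_comm, transitionGiven]
  refine Finset.sum_congr rfl fun e _ => ?_
  simp only [Input.fromEmpty]
  rw [← Finset.sum_mul]
  congr 1
  have hm : MeasurableSet {ω | ∀ i : Fin N, E i ω = e i} := by
    rw [Set.ofPred_forall]
    exact MeasurableSet.iInter fun i => hE i (measurableSet_singleton (e i))
  rw [← measureReal_biUnion_finset]
  · congr 1
    ext ω
    simp
  · intro b _ b' _ hbb'
    exact Set.disjoint_left.2 fun ω h h' => hbb' (h.1.symm.trans h'.1)
  · intro b _
    exact (hB₁ (measurableSet_singleton b)).inter hm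

theorem real_forall_eq_prod (hindep : iIndepFun E P)
    (hident : ∀ n, IdentDistrib (E n) (E 0) P P) {N : ℕ} (e : Fin N → C.harvest) :
    P.real {ω | ∀ i : Fin N, E i ω = e i} = ∏ i, P.real {ω | E 0 ω = e i} := by
  have h := (hindep.precomp (Fin.val_injective (n := N))).measure_inter_preimage_eq_mul
    Finset.univ (sets := fun i => {e i}) fun i _ => measurableSet_singleton (e i)
  have hset : {ω | ∀ i : Fin N, E i ω = e i} =
      ⋂ i ∈ (Finset.univ : Finset (Fin N)), E i ⁻¹' {e i} := by
    ext ω; simp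
  rw [measureReal_def, hset]
  refine (congrArg ENNReal.toReal h).trans ?_
  rw [ENNReal.toReal_prod]
  refine Finset.prod_congr rfl fun i _ => ?_
  exact congrArg ENNReal.toReal ((hident i).measure_mem_eq (measurableSet_singleton (e i)))

theorem transitionGiven_nonneg (b : Fin (C.cap + 1)) {N : ℕ} (u : C.Input N) (y : Fin N → Y) :
    0 ≤ C.transitionGiven P E b u y :=
  Finset.sum_nonneg fun _ _ => mul_nonneg measureReal_nonneg
    (Finset.prod_nonneg fun _ _ => C.W_nonneg _ _)

theorem sum_transitionGiven [IsProbabilityMeasure P] (hE : ∀ n, Measurable (E n))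
    (b : Fin (C.cap + 1)) {N : ℕ} (u : C.Input N) :
    ∑ y, C.transitionGiven P E b u y = 1 := by
  classical
  simp_rw [transitionGiven]
  rw [Finset.sum_comm]
  simp_rw [← Finset.mul_sum]
  have hW : ∀ x : Fin N → X, ∑ y : Fin N → Y, ∏ i, C.W (x i) (y i) = 1 := by
    intro x
    have := Finset.prod_univ_sum (fun _ : Fin N => (Finset.univ : Finset Y)) fun i y => C.W (x i) y
    rw [Fintype.piFinset_univ] at this
    rw [← this]
    simp [C.W_sum]
  simp_rw [hW, mul_one]
  rw [← measureReal_biUnion_finset]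
  · have : (⋃ e ∈ (Finset.univ : Finset (Fin N → C.harvest)),
        {ω | ∀ i : Fin N, E i ω = e i}) = Set.univ := by
      ext ω
      simpa using ⟨fun i : Fin N => E i ω, fun i => rfl⟩
    rw [this]
    simp
  · intro e _ e' _ hee'
    exact Set.disjoint_left.2 fun ω h h' => hee' (funext fun i => (h i).symm.trans (h' i))
  · intro e _
    rw [Set.ofPred_forall]
    exact MeasurableSet.iInter fun i => hE i (measurableSet_singleton (e i))

/-- The second factor is a fresh start from level 0: `append` feeds `v` that level, and the later
energies have the same product law as the first M. -/
theorem transitionGiven_append (hmono : ∀ e, Monotone fun b => C.avail b e)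
    (hindep : iIndepFun E P) (hident : ∀ n, IdentDistrib (E n) (E 0) P P) {N M : ℕ} (b : Fin (C.cap + 1))
    (u : C.Input N) (v : C.Input M) (y : Fin N → Y) (z : Fin M → Y) :
    C.transitionGiven P E b (u.append hmono v) (Fin.append y z) =
      C.transitionGiven P E b u y * C.transitionGiven P E 0 v z := by
  simp_rw [transitionGiven, real_forall_eq_prod hindep hident]
  rw [Fintype.sum_mul_sum, ← (Fin.appendEquiv N M).sum_comp, Fintype.sum_prod_type]
  refine Finset.sum_congr rfl fun e _ => Finset.sum_congr rfl fun e' _ => ?_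
  simp only [Fin.prod_univ_add, Fin.appendEquiv, Equiv.coe_fn_mk, Input.append, Fin.append_left,
    Fin.append_right]
  ring

variable (C P E) in
/-- `n` channel uses from an empty battery simulate the channel `Q`, by means of an encoder of its
inputs and a map from the output blocks to its outputs. -/
def Simulates {A B : Type*} [Fintype B] (Q : A → B → ℝ) (n : ℕ) : Prop :=
  ∃ (f : A → C.Input n) (g : (Fin n → Y) → B), ∀ a (φ : B → ℝ),
    ∑ y, C.transitionGiven P E 0 (f a) y * φ (g y) = ∑ b, Q a b * φ b

theorem Simulates.cons (hmono : ∀ e, Monotone fun b => C.avail b e)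
    (hindep : iIndepFun E P) (hident : ∀ n, IdentDistrib (E n) (E 0) P P)
    {A B : Type*} [Fintype B] {Q : A → B → ℝ} {K n m : ℕ} (h : C.Simulates P E Q n)
    (h' : C.Simulates P E (fun (a : Fin K → A) (z : Fin K → B) => ∏ k, Q (a k) (z k)) m) :
    C.Simulates P E (fun (a : Fin (K + 1) → A) (z : Fin (K + 1) → B) => ∏ k, Q (a k) (z k))
      (n + m) := by
  obtain ⟨f, g, h⟩ := h
  obtain ⟨f', g', h'⟩ := h'
  refine ⟨fun a => (f (a 0)).append hmono (f' fun k => a k.succ),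
    fun y => Fin.cons (g fun i => y (Fin.castAdd m i)) (g' fun i => y (Fin.natAdd n i)),
    fun a φ => ?_⟩
  rw [← (Fin.appendEquiv n m).sum_comp, Fintype.sum_prod_type,
    ← (Fin.consEquiv fun _ => B).sum_comp, Fintype.sum_prod_type]
  simp only [Fin.appendEquiv, Equiv.coe_fn_mk, Fin.append_left, Fin.append_right,
    transitionGiven_append hmono hindep hident, Fin.consEquiv, Fin.prod_univ_succ, Fin.cons_zero,
    Fin.cons_succ, mul_assoc, ← Finset.mul_sum]
  -- Testing against arbitrary φ pays off here: the tail is integrated out with the first output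
  -- letter frozen, then the first block with the resulting function of that letter.
  have h'' : ∀ (a : Fin K → A) (b : B),
      ∑ y, C.transitionGiven P E 0 (f' a) y * φ (Fin.cons b (g' y)) =
        ∑ z : Fin K → B, (∏ k, Q (a k) (z k)) * φ (Fin.cons b z) :=
    fun a b => h' a fun z => φ (Fin.cons b z)
  simp only [h'']
  exact h (a 0) fun b => ∑ z : Fin K → B, (∏ k, Q (a k.succ) (z k)) * φ (Fin.cons b z)

theorem Simulates.pi [IsProbabilityMeasure P] (hmono : ∀ e, Monotone fun b => C.avail b e)
    (hE : ∀ n, Measurable (E n)) (hindep : iIndepFun E P)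
    (hident : ∀ n, IdentDistrib (E n) (E 0) P P) {A B : Type*} [Fintype B] {Q : A → B → ℝ}
    {n : ℕ} (h : C.Simulates P E Q n) (K r : ℕ) :
    C.Simulates P E (fun (a : Fin K → A) (z : Fin K → B) => ∏ k, Q (a k) (z k))
      (K * n + r) := by
  induction K with
  | zero =>
    -- The r spare uses send zeros (`default`) and their outputs are discarded; this covers block
    -- lengths that are not multiples of n.
    refine ⟨fun _ => default, fun _ => Fin.elim0, fun a φ => ?_⟩
    rw [← Finset.sum_mul, sum_transitionGiven hE, Fintype.sum_unique]
    simp only [Finset.univ_eq_empty, Finset.prod_empty, one_mul]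
    exact congrArg φ (Subsingleton.elim _ _)
  | succ K ih =>
    have : (K + 1) * n + r = n + (K * n + r) := by ring
    rw [this]
    exact h.cons hmono hindep hident ih

theorem simulates_transitionGiven (N : ℕ) :
    C.Simulates P E (fun (u : C.Input N) y => C.transitionGiven P E 0 u y) N :=
  ⟨id, id, fun _ _ => rfl⟩

/-- A code for a simulated channel gives a code for the energy harvesting channel. -/
theorem Simulates.exists_code [IsFiniteMeasure P] (hmono : ∀ e, Monotone fun b => C.avail b e)
    (hB₁ : Measurable B₁) (hE : ∀ n, Measurable (E n)) {A B : Type*} [Fintype B]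
    {Q : A → B → ℝ} {n M : ℕ} (h : C.Simulates P E Q n) (enc : Fin M → A) (dec : B → Fin M) :
    ∃ c : C.Code M n, ∀ m, c.errorProb P B₁ E m = ∑ b with dec b ≠ m, Q (enc m) b := by
  obtain ⟨f, g, h⟩ := h
  refine ⟨⟨fun m => (f (enc m)).fromEmpty hmono, fun y => dec (g y)⟩, fun m => ?_⟩
  have := h (enc m) fun b => if dec b ≠ m then 1 else 0
  simp only [mul_ite, mul_one, mul_zero] at this
  rw [Code.errorProb, Finset.sum_filter, Finset.sum_filter]
  simp_rw [transition_fromEmpty hmono hB₁ hE]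
  exact this

end Transition

/-! ### Block rates: maximum, achievability, limit. -/

section Rates

variable {X Y Ω : Type*} [Zero X] [Finite X] [Fintype Y] [MeasurableSpace Ω] {C : EHChannel X Y}
  {P : Measure Ω} {B₁ : Ω → Fin (C.cap + 1)} {E : ℕ → Ω → C.harvest}

theorem isGreatest_lowerRate (N : ℕ) :
    IsGreatest (C.blockRates P E N) (C.lowerRate P E N) := by
  classical
  refine IsCompact.isGreatest_sSup ?_ ?_
  · exact (isCompact_stdSimplex ℝ _).image_of_continuousOn
      (continuousOn_const.mul (continuousOn_mutualInfo fun u y => transitionGiven_nonneg 0 u y))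
  · exact Set.Nonempty.image _ ⟨_, single_mem_stdSimplex ℝ (default : C.Input N)⟩

theorem exists_mutualInfo_eq {N : ℕ} (hN : 1 ≤ N) :
    ∃ p ∈ stdSimplex ℝ (C.Input N),
      mutualInfo p (fun u y => C.transitionGiven P E 0 u y) = N * C.lowerRate P E N := by
  obtain ⟨p, hp, h⟩ := (isGreatest_lowerRate (C := C) (P := P) (E := E) N).1
  refine ⟨p, hp, ?_⟩
  have : (N : ℝ) ≠ 0 := by positivity
  rw [← h]
  field_simp

theorem mutualInfo_le_lowerRate {N : ℕ} (hN : 1 ≤ N) {p : C.Input N → ℝ}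
    (hp : p ∈ stdSimplex ℝ (C.Input N)) :
    mutualInfo p (fun u y => C.transitionGiven P E 0 u y) ≤ N * C.lowerRate P E N := by
  have h := (isGreatest_lowerRate (C := C) (P := P) (E := E) N).2 ⟨p, hp, rfl⟩
  have hN' : (0 : ℝ) < N := by positivity
  rwa [one_div, inv_mul_le_iff₀ hN'] at h

theorem lowerRate_le_logb_card [IsProbabilityMeasure P] (hE : ∀ n, Measurable (E n)) {N : ℕ}
    (hN : 1 ≤ N) : C.lowerRate P E N ≤ Real.logb 2 (Fintype.card Y) := by
  classical
  obtain ⟨p, hp, h⟩ := exists_mutualInfo_eq (C := C) (P := P) (E := E) hN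
  have h' := mutualInfo_le_logb_card hp (Q := fun u y => C.transitionGiven P E 0 u y)
    (fun u y => transitionGiven_nonneg 0 u y) fun u => sum_transitionGiven hE 0 u
  rw [h, Fintype.card_fun, Fintype.card_fin, Nat.cast_pow, Real.logb_pow] at h'
  exact le_of_mul_le_mul_left h' (by positivity)

/-- The largest block mutual informations from an empty battery are superadditive. -/
theorem lowerRate_superadditive [IsProbabilityMeasure P]
    (hmono : ∀ e, Monotone fun b => C.avail b e) (hE : ∀ n, Measurable (E n))
    (hindep : iIndepFun E P) (hident : ∀ n, IdentDistrib (E n) (E 0) P P) {N M : ℕ}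
    (hN : 1 ≤ N) (hM : 1 ≤ M) :
    N * C.lowerRate P E N + M * C.lowerRate P E M ≤
      ((N + M : ℕ) : ℝ) * C.lowerRate P E (N + M) := by
  classical
  obtain ⟨p, hp, h⟩ := exists_mutualInfo_eq (C := C) (P := P) (E := E) hN
  obtain ⟨p', hp', h'⟩ := exists_mutualInfo_eq (C := C) (P := P) (E := E) hM
  rw [← h, ← h', ← mutualInfo_prod hp hp' (fun u y => transitionGiven_nonneg 0 u y)
    (fun u => sum_transitionGiven hE 0 u) (fun u y => transitionGiven_nonneg 0 u y)
    (fun u => sum_transitionGiven hE 0 u)]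
  -- The product of the two optimal laws, pushed forward along `append`, is a competitor for block
  -- length N + M.
  have heq : (fun (a : C.Input N × C.Input M) (b : (Fin N → Y) × (Fin M → Y)) =>
      C.transitionGiven P E 0 a.1 b.1 * C.transitionGiven P E 0 a.2 b.2) = fun a b =>
      C.transitionGiven P E 0 (a.1.append hmono a.2) (Fin.appendEquiv N M b) := by
    ext a b
    exact (transitionGiven_append hmono hindep hident 0 a.1 a.2 b.1 b.2).symm
  rw [heq, mutualInfo_comp_equiv (Fin.appendEquiv N M) _
    fun (a : C.Input N × C.Input M) y => C.transitionGiven P E 0 (a.1.append hmono a.2) y,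
    ← mutualInfo_map (fun a : C.Input N × C.Input M => a.1.append hmono a.2) _
      fun u y => C.transitionGiven P E 0 u y]
  refine mutualInfo_le_lowerRate (by omega) ⟨fun u => ?_, ?_⟩
  · exact Finset.sum_nonneg fun a _ => mul_nonneg (hp.1 _) (hp'.1 _)
  · refine (Finset.sum_fiberwise _ _ _).trans ?_
    rw [Fintype.sum_prod_type]
    simp_rw [← Finset.mul_sum, hp'.2, mul_one, hp.2]

theorem achievable_lowerRate [IsProbabilityMeasure P]
    (hmono : ∀ e, Monotone fun b => C.avail b e) (hB₁ : Measurable B₁)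
    (hE : ∀ n, Measurable (E n)) (hindep : iIndepFun E P)
    (hident : ∀ n, IdentDistrib (E n) (E 0) P P) {N : ℕ} (hN : 1 ≤ N) :
    C.Achievable P B₁ E (C.lowerRate P E N) := by
  intro ε hε
  set R := C.lowerRate P E N
  have hN0 : (0 : ℝ) < N := by positivity
  -- A single message, decoded without error, suffices when the target rate is not positive; the
  -- coding theorem needs a positive rate.
  rcases le_or_gt (R - ε) 0 with hR | hR
  · refine Eventually.of_forall fun n => ⟨1, le_rfl, by simpa using hR,
      ⟨fun _ => default, fun _ => 0⟩, fun m => ?_⟩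
    rw [Code.errorProb, Finset.filter_false_of_mem fun y _ => by
      simpa using Subsingleton.elim _ _]
    simpa using hε.le
  obtain ⟨p, hp, hI⟩ := exists_mutualInfo_eq (C := C) (P := P) (E := E) hN
  have hcode := eventually_exists_code hp (Q := fun u y => C.transitionGiven P E 0 u y)
    (fun u y => transitionGiven_nonneg 0 u y) (fun u => sum_transitionGiven hE 0 u)
    (r := N * (R - ε / 2)) (mul_pos hN0 (by linarith))
    (by rw [hI]; exact mul_lt_mul_of_pos_left (by linarith) hN0) hε
  -- Half of ε is kept below capacity of the block channel; the other half, over K = n / N blocks,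
  -- pays for the incomplete last block, that is for n ≤ (K + 1) N.
  have hlarge : ∀ᶠ K : ℕ in atTop, R - ε ≤ K * (ε / 2) :=
    (tendsto_natCast_atTop_atTop.atTop_mul_const (half_pos hε)).eventually_ge_atTop _
  filter_upwards [(Nat.tendsto_div_const_atTop (by omega : N ≠ 0)).eventually
    (hcode.and hlarge), eventually_ge_atTop 1] with n hn hn1
  obtain ⟨⟨M, hM, hrate, enc, dec, hdec⟩, hK⟩ := hn
  have hn0 : (0 : ℝ) < n := by positivity
  refine ⟨M, hM, ?_, ?_⟩
  · have hle : (n : ℝ) ≤ ((n / N : ℕ) + 1 : ℝ) * N := by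
      have := (Nat.lt_div_mul_add (a := n) (b := N) (by omega)).le
      have h2 : n ≤ (n / N + 1) * N := by rw [add_mul, one_mul]; exact this
      exact_mod_cast h2
    rw [le_div_iff₀ hn0]
    refine le_trans ?_ hrate
    calc (R - ε) * n ≤ (R - ε) * (((n / N : ℕ) + 1 : ℝ) * N) :=
          mul_le_mul_of_nonneg_left hle hR.le
      _ = N * ((n / N : ℕ) * (R - ε) + (R - ε)) := by ring
      _ ≤ N * ((n / N : ℕ) * (R - ε) + (n / N : ℕ) * (ε / 2)) := by gcongr
      _ = (n / N : ℕ) * (N * (R - ε / 2)) := by ring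
  · have hsim := (simulates_transitionGiven (C := C) (P := P) (E := E) N).pi hmono hE hindep
      hident (n / N) (n % N)
    rw [Nat.div_add_mod'] at hsim
    obtain ⟨c, hc⟩ := hsim.exists_code hmono hB₁ hE enc dec
    exact ⟨c, fun m => (hc m).trans_le (hdec m)⟩

theorem exists_tendsto_lowerRate [IsProbabilityMeasure P]
    (hmono : ∀ e, Monotone fun b => C.avail b e) (hE : ∀ n, Measurable (E n))
    (hindep : iIndepFun E P) (hident : ∀ n, IdentDistrib (E n) (E 0) P P) :
    ∃ L : ℝ, Tendsto (fun N => C.lowerRate P E N) atTop (𝓝 L) ∧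
      IsLUB ((fun N => C.lowerRate P E N) '' Set.Ici 1) L := by
  -- Fekete's lemma for the negated sequence. The factor N makes the value at 0 vanish, so index 0
  -- is harmless.
  have hsub : Subadditive fun N : ℕ => -(N * C.lowerRate P E N) := by
    intro m n
    rcases Nat.eq_zero_or_pos m with rfl | hm
    · simp
    rcases Nat.eq_zero_or_pos n with rfl | hn
    · simp
    have := lowerRate_superadditive hmono hE hindep hident hm hn
    linarith
  have hdiv : ∀ N : ℕ, 1 ≤ N → -(N * C.lowerRate P E N) / N = -C.lowerRate P E N := by
    intro N hN
    have : (N : ℝ) ≠ 0 := by positivity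
    field_simp
  have hbdd : BddBelow (Set.range fun N : ℕ => -(N * C.lowerRate P E N) / N) := by
    -- The 0 accounts for N = 0, where the quotient is 0 / 0 = 0.
    refine ⟨min 0 (-Real.logb 2 (Fintype.card Y)), ?_⟩
    rintro _ ⟨N, rfl⟩
    rcases Nat.eq_zero_or_pos N with rfl | hN
    · simp
    · simp only [hdiv N hN]
      exact (min_le_right _ _).trans (neg_le_neg (lowerRate_le_logb_card hE hN))
  have hlim : Tendsto (fun N => C.lowerRate P E N) atTop (𝓝 (-hsub.lim)) := by
    refine ((hsub.tendsto_lim hbdd).neg).congr' ?_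
    filter_upwards [eventually_ge_atTop 1] with N hN
    rw [hdiv N hN, neg_neg]
  refine ⟨-hsub.lim, hlim, ?_, fun b hb => ?_⟩
  · rintro _ ⟨N, hN, rfl⟩
    have := hsub.lim_le_div hbdd (n := N) (Nat.one_le_iff_ne_zero.1 hN)
    rw [hdiv N hN] at this
    exact le_neg_of_le_neg this
  · refine le_of_tendsto hlim ?_
    filter_upwards [eventually_ge_atTop 1] with N hN
    exact hb ⟨N, hN, rfl⟩

end Rates

end EHChannel

theorem mainTheorem3 {X Y Ω : Type*} [Zero X] [Finite X] [Fintype Y] [MeasurableSpace Ω]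
    (C : EHChannel X Y)
    -- a fuller battery never makes less energy available
    (hmono : ∀ e, Monotone fun b => C.avail b e)
    (P : Measure Ω) [IsProbabilityMeasure P]
    (B₁ : Ω → Fin (C.cap + 1)) (E : ℕ → Ω → C.harvest)
    (hB₁ : Measurable B₁) (hE : ∀ n, Measurable (E n))
    (hB₁E : IndepFun B₁ (fun ω n => E n ω) P)
    (hindep : iIndepFun E P) (hident : ∀ n, IdentDistrib (E n) (E 0) P P) :
    (∀ N : ℕ, 1 ≤ N →
      IsGreatest (C.blockRates P E N) (C.lowerRate P E N) ∧
      C.Achievable P B₁ E (C.lowerRate P E N) ∧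
      ((C.lowerRate P E N : ℝ) : EReal) ≤ C.capacity P B₁ E) ∧
    ∃ L : ℝ, Tendsto (fun N => C.lowerRate P E N) atTop (𝓝 L) ∧
      IsLUB ((fun N => C.lowerRate P E N) '' Set.Ici 1) L :=
  ⟨fun N hN => ⟨EHChannel.isGreatest_lowerRate N,
    EHChannel.achievable_lowerRate hmono hB₁ hE hindep hident hN,
    le_sSup ⟨_, EHChannel.achievable_lowerRate hmono hB₁ hE hindep hident hN, rfl⟩⟩,
    EHChannel.exists_tendsto_lowerRate hmono hE hindep hident⟩
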